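/- **Corollary 3 (Thue–Morse prefix normal forms).** An infinite binary word is a sequence $w = w_1w_2w_3\cdots$ with letters in $\{0,1\}$; it is called aperiodic if it is not of the form $vu^{\omega}$ with $v$ a (possibly empty) finite word and $u$ a non-empty finite word, where $u^{\omega} = uuu\cdots$. For $a\in\{0,1\}$ and $n \ge 0$, let $F^a_w(n)$ be the maximum number of occurrences of $a$ in a factor (contiguous block) of $w$ of length $n$. The prefix normal forms of $w$ are the infinite binary words $\mathrm{PNF}_1(w)$ and $\mathrm{PNF}_0(w)$ whose $n$-th letters ($n\ge 1$) are $F^1_w(n)-F^1_w(n-1)$ and $1-\bigl(F^0_w(n)-F^0_w(n-1)\bigr)$, respectively. Let $\mu_{\mathrm{TM}}$ be the Thue–Morse morphism, which replaces each letter $0$ of a word by $01$ and each letter $1$ by $10$. Let $w$ be an aperiodic infinite binary word. Then $\mathrm{PNF}_1(w) = 1(10)^{\omega}$ and $\mathrm{PNF}_0(w) = 0(01)^{\omega}$ if and only if $w = \mu_{\mathrm{TM}}(w')$, $w = 0\,\mu_{\mathrm{TM}}(w')$ or $w = 1\,\mu_{\mathrm{TM}}(w')$ for some infinite binary word $w'$.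 -/

import Mathlib

/-- Binary letters: `true` is the letter `1` and `false` is the letter `0`.
An infinite binary word `w₁w₂w₃⋯` is the stream whose entry of index `i` is `w_{i+1}`. -/
abbrev InfWord : Type := Stream' Bool

/-- `x` is a factor of `w`: `w = u x v` for a finite word `u` and an infinite word `v`. -/
def IsFactor (x : List Bool) (w : InfWord) : Prop :=
  ∃ (u : List Bool) (v : InfWord), w = u ++ₛ (x ++ₛ v)

/-- `w = u^ω` for some non-empty finite word `u`. -/
def IsPeriodicWord (w : InfWord) : Prop :=
  ∃ (u : List Bool) (hu : u ≠ []), w = Stream'.cycle u hu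

/-- `w = v u^ω` for some finite word `v` and some non-empty finite word `u`. -/
def IsUltimatelyPeriodicWord (w : InfWord) : Prop :=
  ∃ (v u : List Bool) (hu : u ≠ []), w = v ++ₛ Stream'.cycle u hu

/-- `w` is neither periodic nor ultimately periodic. -/
def IsAperiodicWord (w : InfWord) : Prop :=
  ¬ IsPeriodicWord w ∧ ¬ IsUltimatelyPeriodicWord w

/-- The numbers of occurrences of the letter `a` in the factors of length `n` of `w`. -/
def factorCounts (a : Bool) (w : InfWord) (n : ℕ) : Set ℕ :=
  {k | ∃ u : List Bool, IsFactor u w ∧ u.length = n ∧ u.count a = k}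

/-- `F^a_w(n)`, the maximum number of occurrences of `a` in a factor of length `n` of `w`
(a true maximum, by `isGreatest_maxCount`). -/
noncomputable def maxCount (a : Bool) (w : InfWord) (n : ℕ) : ℕ :=
  sSup (factorCounts a w n)

theorem isGreatest_maxCount (a : Bool) (w : InfWord) (n : ℕ) :
    IsGreatest (factorCounts a w n) (maxCount a w n) := by
  have hne : (factorCounts a w n).Nonempty :=
    ⟨_, w.take n, ⟨[], w.drop n, by simp [Stream'.append_take_drop]⟩, by simp, rfl⟩
  have hb : BddAbove (factorCounts a w n) := by
    refine ⟨n, ?_⟩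
    rintro k ⟨u, -, rfl, rfl⟩
    exact List.count_le_length
  exact ⟨Nat.sSup_mem hne hb, fun k hk => le_csSup hb hk⟩

theorem maxCount_succ (a : Bool) (w : InfWord) (n : ℕ) :
    maxCount a w (n + 1) = maxCount a w n ∨ maxCount a w (n + 1) = maxCount a w n + 1 := by
  obtain ⟨⟨u, ⟨p, v, hw⟩, hl, hc⟩, hub⟩ := isGreatest_maxCount a w n
  obtain ⟨⟨u', ⟨p', v', hw'⟩, hl', hc'⟩, hub'⟩ := isGreatest_maxCount a w (n + 1)
  have h1 : maxCount a w n ≤ maxCount a w (n + 1) := by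
    have hmem : (u ++ [v.head]).count a ∈ factorCounts a w (n + 1) := by
      refine ⟨u ++ [v.head], ⟨p, v.tail, ?_⟩, by simp [hl], rfl⟩
      rw [hw, Stream'.append_append_stream]
      congr 2
      change v = Stream'.cons v.head v.tail
      exact (Stream'.eta v).symm
    have h := hub' hmem
    rw [List.count_append] at h
    omega
  have h2 : maxCount a w (n + 1) ≤ maxCount a w n + 1 := by
    cases u' with
    | nil => simp at hl'
    | cons b t =>
      have hmem : t.count a ∈ factorCounts a w n := by
        refine ⟨t, ⟨p' ++ [b], v', ?_⟩, by simpa using hl', rfl⟩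
        rw [hw', Stream'.append_append_stream]
        rfl
      have h := hub hmem
      rw [List.count_cons] at hc'
      split_ifs at hc' <;> omega
  omega

/-- The prefix normal form with respect to `1`: its `n`-th letter, `n ≥ 1`, is
`F^1_w(n) - F^1_w(n-1)`, which is `0` or `1`. -/
noncomputable def PNF₁ (w : InfWord) : InfWord :=
  fun n => decide (maxCount true w (n + 1) - maxCount true w n = 1)

/-- The prefix normal form with respect to `0`: its `n`-th letter, `n ≥ 1`, is the complement of
`F^0_w(n) - F^0_w(n-1)`, which is `0` or `1`. -/
noncomputable def PNF₀ (w : InfWord) : InfWord :=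
  fun n => !decide (maxCount false w (n + 1) - maxCount false w n = 1)

theorem PNF₁_get (w : InfWord) (n : ℕ) :
    (((PNF₁ w).get n).toNat : ℤ) = maxCount true w (n + 1) - maxCount true w n := by
  rcases maxCount_succ true w n with h | h <;> simp [PNF₁, Stream'.get, h]

theorem PNF₀_get (w : InfWord) (n : ℕ) :
    (((PNF₀ w).get n).toNat : ℤ) = 1 - (maxCount false w (n + 1) - maxCount false w n) := by
  rcases maxCount_succ false w n with h | h <;> simp [PNF₀, Stream'.get, h]

/-- The Thue–Morse morphism on letters: `0 ↦ 01`, `1 ↦ 10`. -/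
def thueMorseLetter (a : Bool) : List Bool := [a, !a]

/-- The Thue–Morse morphism on infinite words: the concatenation of the images (all of length `2`)
of the letters. -/
def thueMorse (w : InfWord) : InfWord :=
  fun n => (thueMorseLetter (w.get (n / 2)))[n % 2]'(Nat.mod_lt n two_pos)

theorem thueMorse_cons (a : Bool) (w : InfWord) :
    thueMorse (Stream'.cons a w) = thueMorseLetter a ++ₛ thueMorse w := by
  funext n
  match n with
  | 0 => rfl
  | 1 => rfl
  | n + 2 =>
    have h1 : (n + 2) / 2 = n / 2 + 1 := by omega
    have h2 : (n + 2) % 2 = n % 2 := by omega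
    change (thueMorseLetter ((Stream'.cons a w).get ((n + 2) / 2)))[(n + 2) % 2]'_ = thueMorse w n
    simp only [h1, h2]
    rfl

/-! Both normal forms together say that `F^a_w(n) = ⌊n/2⌋ + 1` for each letter `a` and all `n ≥ 1`,
and the right-hand side says that `w`, after dropping `p ≤ 1` letters, splits into blocks `01` and
`10`. Write `D(n) = 2T(n) - n`, with `T(n)` the number of `1`s among the first `n` letters; `D` is a
walk with steps `±1`. The maxima confine `D` to a band of width 2. A double letter moves `D` from
one edge of the band to the other, so all double letters start at positions of one parity, which
gives the blocks (`blocks_of_maxCount`). Conversely, blocks keep `D` within 1 of `D(p)`, which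
bounds the maxima; aperiodicity is what makes the bound attained (`exists_unequal_blocks`,
`maxCount_of_blocks`). -/

/-! ### Factor counts as differences of prefix counts -/

theorem mem_factorCounts_iff (a : Bool) (w : InfWord) (n k : ℕ) :
    k ∈ factorCounts a w n ↔
      ∃ i, Nat.count (fun j => w.get j = a) (i + n) = Nat.count (fun j => w.get j = a) i + k := by
  have hcount : ∀ (n : ℕ) (v : InfWord), (v.take n).count a = Nat.count (fun j => v.get j = a) n := by
    intro n
    induction n with
    | zero => simp
    | succ n ih =>
      intro v
      rw [Stream'.take_succ, List.count_cons, ih, Nat.count_succ']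
      have h : (v.head == a) = true ↔ v.get 0 = a := by
        rw [beq_iff_eq]
      simp only [h]
      rfl
  have hdrop : ∀ i, ((w.drop i).take n).count a + Nat.count (fun j => w.get j = a) i =
      Nat.count (fun j => w.get j = a) (i + n) := by
    intro i
    rw [hcount, Nat.count_add, add_comm]
    congr 2
    funext j
    change (w.get (j + i) = a) = (w.get (i + j) = a)
    rw [add_comm]
  constructor
  · rintro ⟨u, ⟨p, v, hw⟩, rfl, rfl⟩
    refine ⟨p.length, ?_⟩
    rw [← hdrop, add_comm]
    congr 2
    rw [hw, Stream'.drop_append_stream]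
    simpa using (Stream'.append_take (x := u) (a := v) (n := 0)).symm
  · rintro ⟨i, hi⟩
    refine ⟨(w.drop i).take n, ⟨w.take i, (w.drop i).drop n, ?_⟩, by simp, ?_⟩
    · rw [Stream'.append_take_drop, Stream'.append_take_drop]
    · have := hdrop i
      omega

theorem count_add_two (p : ℕ → Prop) [DecidablePred p] (n : ℕ) :
    Nat.count p (n + 2) = Nat.count p n + (if p n then 1 else 0) + (if p (n + 1) then 1 else 0) := by
  rw [Nat.count_succ, Nat.count_succ]

theorem count_false_add_count_true (w : InfWord) (n : ℕ) :
    Nat.count (fun j => w.get j = false) n + Nat.count (fun j => w.get j = true) n = n := by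
  induction n with
  | zero => simp
  | succ n ih =>
    rw [Nat.count_succ, Nat.count_succ]
    cases w.get n <;> simp <;> omega

theorem maxCount_zero (a : Bool) (w : InfWord) : maxCount a w 0 = 0 := by
  obtain ⟨i, hi⟩ := (mem_factorCounts_iff a w 0 _).1 (isGreatest_maxCount a w 0).1
  simpa using hi

/-! ### The prefix normal forms in terms of the maxima -/

theorem cycle_pair_get (a b : Bool) (h : [a, b] ≠ []) (n : ℕ) :
    (Stream'.cycle [a, b] h).get n = if n % 2 = 0 then a else b := by
  have key : Stream'.cycle [a, b] h =
      Stream'.cons a (Stream'.cons b (Stream'.cycle [a, b] h)) := Stream'.cycle_eq _ _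
  induction n using Nat.strong_induction_on with
  | _ n ih =>
    match n with
    | 0 => rw [key]; rfl
    | 1 => rw [key]; rfl
    | n + 2 =>
      rw [key, Nat.add_mod_right]
      exact ih n (by omega)

theorem eq_cons_cycle_iff (s : InfWord) (a b c : Bool) (h : [b, c] ≠ []) :
    s = [a] ++ₛ Stream'.cycle [b, c] h ↔
      s.get 0 = a ∧ ∀ n, s.get (n + 1) = if n % 2 = 0 then b else c := by
  simp only [← cycle_pair_get b c h]
  constructor
  · rintro rfl
    exact ⟨rfl, fun n => rfl⟩
  · rintro ⟨h0, h1⟩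
    refine Stream'.ext fun n => ?_
    cases n with
    | zero => exact h0
    | succ n => exact h1 n

/-- `F^a_w(n) = ⌊n/2⌋ + 1` for `n ≥ 1` expresses that the increments of `F^a_w` are
`1, 1, 0, 1, 0, …`. -/
theorem maxCount_increments_iff (a : Bool) (w : InfWord) :
    (maxCount a w 1 - maxCount a w 0 = 1 ∧
      ∀ n, (maxCount a w (n + 1 + 1) - maxCount a w (n + 1) = 1 ↔ n % 2 = 0)) ↔
    ∀ n, maxCount a w (n + 1) = (n + 1) / 2 + 1 := by
  constructor
  · rintro ⟨h0, h1⟩ n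
    rw [maxCount_zero] at h0
    induction n with
    | zero => simpa using h0
    | succ n ih =>
      have h2 := h1 n
      rcases maxCount_succ a w (n + 1) with h | h <;> omega
  · intro h
    refine ⟨by simp [h 0, maxCount_zero], fun n => ?_⟩
    rw [h, h]
    omega

theorem PNF₁_eq_iff (w : InfWord) :
    PNF₁ w = [true] ++ₛ Stream'.cycle [true, false] (List.cons_ne_nil _ _) ↔
      ∀ n, maxCount true w (n + 1) = (n + 1) / 2 + 1 := by
  rw [eq_cons_cycle_iff, ← maxCount_increments_iff]
  refine and_congr (by simp [PNF₁, Stream'.get]) (forall_congr' fun n => ?_)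
  by_cases h : n % 2 = 0 <;> simp [PNF₁, Stream'.get, h]

theorem PNF₀_eq_iff (w : InfWord) :
    PNF₀ w = [false] ++ₛ Stream'.cycle [false, true] (List.cons_ne_nil _ _) ↔
      ∀ n, maxCount false w (n + 1) = (n + 1) / 2 + 1 := by
  rw [eq_cons_cycle_iff, ← maxCount_increments_iff]
  refine and_congr (by simp [PNF₀, Stream'.get]) (forall_congr' fun n => ?_)
  by_cases h : n % 2 = 0 <;> simp [PNF₀, Stream'.get, h]

/-! ### Thue–Morse images as block decompositions -/

theorem eq_thueMorse_iff (w : InfWord) :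
    (∃ w', w = thueMorse w') ↔ ∀ i, w.get (2 * i + 1) = !w.get (2 * i) := by
  have even : ∀ (w' : InfWord) (i : ℕ), (thueMorse w').get (2 * i) = w'.get i := by
    intro w' i
    have h1 : 2 * i / 2 = i := by omega
    have h2 : 2 * i % 2 = 0 := by omega
    change (thueMorseLetter _)[_]'_ = _
    simp only [h1, h2]
    rfl
  have odd : ∀ (w' : InfWord) (i : ℕ), (thueMorse w').get (2 * i + 1) = !w'.get i := by
    intro w' i
    have h1 : (2 * i + 1) / 2 = i := by omega
    have h2 : (2 * i + 1) % 2 = 1 := by omega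
    change (thueMorseLetter _)[_]'_ = _
    simp only [h1, h2]
    rfl
  constructor
  · rintro ⟨w', rfl⟩ i
    rw [even, odd]
  · intro h
    refine ⟨w.even, ?_⟩
    refine Stream'.ext fun n => ?_
    obtain ⟨i, rfl | rfl⟩ := Nat.even_or_odd' n
    · rw [even, Stream'.get_even]
    · rw [odd, h, Stream'.get_even]

theorem thueMorse_shape_iff (w : InfWord) :
    (∃ w' : InfWord,
      w = thueMorse w' ∨ w = [false] ++ₛ thueMorse w' ∨ w = [true] ++ₛ thueMorse w') ↔
    ∃ p, p ≤ 1 ∧ ∀ i, w.get (2 * i + p + 1) = !w.get (2 * i + p) := by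
  constructor
  · rintro ⟨w', h | h | h⟩
    · exact ⟨0, by omega, (eq_thueMorse_iff w).1 ⟨w', h⟩⟩
    all_goals
      refine ⟨1, le_rfl, ?_⟩
      have := (eq_thueMorse_iff (thueMorse w')).1 ⟨w', rfl⟩
      rw [h]
      exact this
  · rintro ⟨p, hp, h⟩
    interval_cases p
    · obtain ⟨w', hw'⟩ := (eq_thueMorse_iff w).2 h
      exact ⟨w', Or.inl hw'⟩
    · obtain ⟨w', hw'⟩ := (eq_thueMorse_iff w.tail).2 h
      refine ⟨w', Or.inr ?_⟩
      rw [← hw']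
      have hc : w = [w.head] ++ₛ w.tail := (Stream'.eta w).symm
      cases hh : w.head <;> rw [hh] at hc
      · exact Or.inl hc
      · exact Or.inr hc

/-! ### Eventual periods and aperiodicity -/

theorem isUltimatelyPeriodicWord_of_eventually (w : InfWord) (N k : ℕ) (hk : 0 < k)
    (h : ∀ i, N ≤ i → w.get (i + k) = w.get i) : IsUltimatelyPeriodicWord w := by
  have hne : (w.drop N).take k ≠ [] := by
    intro h0
    have := congrArg List.length h0
    simp at this
    omega
  refine ⟨w.take N, (w.drop N).take k, hne, ?_⟩
  have hper : w.drop N = (w.drop N).take k ++ₛ w.drop N := by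
    conv_lhs => rw [← Stream'.append_take_drop k (w.drop N)]
    congr 1
    funext i
    change w.get (i + k + N) = w.get (i + N)
    rw [← h (i + N) (by omega)]
    congr 1
    omega
  have hcyc := Stream'.cycle_eq _ hne
  -- For non-empty `u`, the equation `s = us` determines every letter of `s`.
  have huniq : ∀ (u : List Bool) (s t : InfWord), 0 < u.length → s = u ++ₛ s → t = u ++ₛ t →
      s = t := by
    intro u s t hu hs ht
    funext n
    induction n using Nat.strong_induction_on with
    | _ n ih =>
      change s.get n = t.get n
      rw [hs, ht]
      rcases lt_or_ge n u.length with hn | hn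
      · rw [Stream'.get_append_left _ _ _ hn, Stream'.get_append_left _ _ _ hn]
      · obtain ⟨m, rfl⟩ := Nat.exists_eq_add_of_le hn
        rw [Stream'.get_append_right, Stream'.get_append_right]
        exact ih m (by omega)
  conv_lhs => rw [← Stream'.append_take_drop N w]
  congr 1
  exact huniq _ _ _ (by simpa using hk) hper hcyc

/-- A word in which `a` is always followed by `a` at distance `k` has eventual period `k`. -/
theorem eventually_periodic_of_persistent (v : ℕ → Bool) (a : Bool) (k : ℕ) (hk : 0 < k)
    (h : ∀ i, v i = a → v (i + k) = a) : ∃ N, ∀ i, N ≤ i → v (i + k) = v i := by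
  have hmul : ∀ i m, v i = a → v (i + k * m) = a := by
    intro i m hi
    induction m with
    | zero => simpa using hi
    | succ m ih => rw [Nat.mul_succ, ← add_assoc]; exact h _ ih
  have hres : ∀ r, ∃ N, ∀ i, N ≤ i → i % k = r → v (i + k) = v i := by
    intro r
    -- In a residue class mod `k`, one occurrence of `a` forces `a` from there on; with no
    -- occurrence the class is constantly `!a`.
    by_cases hr : ∃ j, j % k = r ∧ v j = a
    · obtain ⟨j, hj, hja⟩ := hr
      refine ⟨j, fun i hi hir => ?_⟩
      have hi' : v i = a := by
        obtain ⟨m, hm⟩ := (Nat.modEq_iff_dvd' hi).1 (hj.trans hir.symm)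
        have : i = j + k * m := by omega
        rw [this]
        exact hmul j m hja
      rw [h i hi', hi']
    · push Not at hr
      refine ⟨0, fun i _ hir => ?_⟩
      have h1 := hr i hir
      have h2 := hr (i + k) (by simpa using hir)
      revert h1 h2
      cases v i <;> cases v (i + k) <;> cases a <;> simp
  choose N hN using hres
  refine ⟨(Finset.range k).sup N, fun i hi => hN (i % k) i (le_trans ?_ hi) rfl⟩
  exact Finset.le_sup (f := N) (Finset.mem_range.2 (Nat.mod_lt i hk))

/-- Otherwise `!a` as first letter of a block persists at distance `k`, so the first letters have
eventual period `k`. They determine the blocks, so `w` would have eventual period `2k`. -/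
theorem exists_unequal_blocks (w : InfWord) (hw : ¬ IsUltimatelyPeriodicWord w) (p : ℕ)
    (hp : ∀ i, w.get (2 * i + p + 1) = !w.get (2 * i + p)) (a : Bool) (k : ℕ) (hk : 0 < k) :
    ∃ i, w.get (2 * i + p) = !a ∧ w.get (2 * (i + k) + p) = a := by
  by_contra hcon
  push Not at hcon
  obtain ⟨N, hN⟩ := eventually_periodic_of_persistent (fun i => w.get (2 * i + p)) (!a) k hk
    (fun i hi => Bool.eq_not_of_ne (hcon i hi))
  refine hw (isUltimatelyPeriodicWord_of_eventually w (2 * N + p) (2 * k) (by omega) ?_)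
  intro n hn
  obtain ⟨m, rfl⟩ := Nat.exists_eq_add_of_le hn
  obtain ⟨i, rfl | rfl⟩ := Nat.even_or_odd' m
  · have := hN (N + i) (by omega)
    convert this using 2 <;> ring
  · have := hN (N + i) (by omega)
    have h1 := hp (N + i + k)
    have h2 := hp (N + i)
    have h3 : w.get (2 * (N + i + k) + p + 1) = w.get (2 * (N + i) + p + 1) := by
      rw [h1, h2]
      exact congrArg _ this
    convert h3 using 2 <;> ring

/-! ### Blocks determine the maxima -/

theorem count_block (w : InfWord) (p : ℕ) (hp : ∀ i, w.get (2 * i + p + 1) = !w.get (2 * i + p))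
    (a : Bool) (i : ℕ) :
    Nat.count (fun j => w.get j = a) (2 * i + p) = i + Nat.count (fun j => w.get j = a) p := by
  induction i with
  | zero => simp
  | succ i ih =>
    have h : 2 * (i + 1) + p = 2 * i + p + 2 := by ring
    rw [h, count_add_two, ih, hp]
    cases w.get (2 * i + p) <;> cases a <;> simp <;> omega

theorem count_step (w : InfWord) (a : Bool) (n : ℕ) :
    Nat.count (fun j => w.get j = a) n ≤ Nat.count (fun j => w.get j = a) (n + 1) ∧
    Nat.count (fun j => w.get j = a) (n + 1) ≤ Nat.count (fun j => w.get j = a) n + 1 := by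
  rw [Nat.count_succ]
  split_ifs <;> omega

theorem maxCount_of_blocks (w : InfWord) (hw : ¬ IsUltimatelyPeriodicWord w) (p : ℕ)
    (hp1 : p ≤ 1) (hp : ∀ i, w.get (2 * i + p + 1) = !w.get (2 * i + p)) (a : Bool) (n : ℕ) :
    maxCount a w (n + 1) = (n + 1) / 2 + 1 := by
  have hB := count_block w p hp a
  have hS := count_step w a
  refine (isGreatest_maxCount a w (n + 1)).unique ⟨?_, ?_⟩
  · rw [mem_factorCounts_iff]
    -- The window starts at the last letter `a` of block `i`. For length `2m` it covers `m - 1`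
    -- whole blocks and the first letter `a` of block `i + m`; for length `2m + 1` it covers `m`
    -- whole blocks.
    obtain ⟨i, hi, hi'⟩ := exists_unequal_blocks w hw p hp a
      ((n + 2) / 2) (by omega)
    have e1 : Nat.count (fun j => w.get j = a) (2 * i + p + 1) = i + Nat.count (fun j => w.get j = a) p := by
      rw [Nat.count_succ, hB, hi]
      cases a <;> simp
    refine ⟨2 * i + p + 1, ?_⟩
    rw [e1]
    obtain ⟨m, hm | hm⟩ := Nat.even_or_odd' (n + 1)
    · have e2 : (n + 2) / 2 = m := by omega
      rw [e2] at hi'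
      have e3 : 2 * i + p + 1 + (n + 1) = 2 * (i + m) + p + 1 := by omega
      rw [e3, Nat.count_succ, hB, if_pos hi']
      omega
    · have e3 : 2 * i + p + 1 + (n + 1) = 2 * (i + m + 1) + p := by omega
      rw [e3, hB]
      omega
  · intro k hk
    obtain ⟨i, hi⟩ := (mem_factorCounts_iff a w (n + 1) k).1 hk
    -- For the analogue of `D` counting `a`, this is `|D(x) - D(p)| ≤ 1`.
    have bounds : ∀ x, 2 * Nat.count (fun j => w.get j = a) x + p ≤
        x + 2 * Nat.count (fun j => w.get j = a) p + 1 ∧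
        x + 2 * Nat.count (fun j => w.get j = a) p ≤ 2 * Nat.count (fun j => w.get j = a) x + p + 1 := by
      intro x
      rcases lt_or_ge x p with hx | hx
      · obtain rfl : x = 0 := by omega
        obtain rfl : p = 1 := by omega
        have := hS 0
        simp only [Nat.count_zero, zero_add] at this ⊢
        omega
      · obtain ⟨y, rfl⟩ := Nat.exists_eq_add_of_le hx
        obtain ⟨m, rfl | rfl⟩ := Nat.even_or_odd' y
        · have := hB m
          rw [add_comm p]
          omega
        · have h1 := hB m
          have h2 := hS (2 * m + p)
          have h3 : p + (2 * m + 1) = 2 * m + p + 1 := by omega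
          rw [h3]
          omega
    have h1 := bounds i
    have h2 := bounds (i + (n + 1))
    omega

/-! ### The maxima force blocks -/

theorem blocks_of_maxCount (w : InfWord)
    (h : ∀ a n, maxCount a w (n + 1) = (n + 1) / 2 + 1) :
    ∃ p, p ≤ 1 ∧ ∀ i, w.get (2 * i + p + 1) = !w.get (2 * i + p) := by
  have window : ∀ a x n, Nat.count (fun j => w.get j = a) (x + n) ≤
      Nat.count (fun j => w.get j = a) x + n / 2 + 1 := by
    intro a x n
    cases n with
    | zero => simp
    | succ n =>
      obtain ⟨k, hk⟩ := Nat.exists_eq_add_of_le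
        (Nat.count_monotone (fun j => w.get j = a) (Nat.le_add_right x (n + 1)))
      have := (isGreatest_maxCount a w (n + 1)).2 ((mem_factorCounts_iff a w (n + 1) k).2 ⟨x, hk⟩)
      rw [h] at this
      omega
  -- This is `|D(y) - D(x)| ≤ 2`; the lower bound comes from counting `0`s.
  have bound : ∀ x y, x ≤ y →
      2 * Nat.count (fun j => w.get j = true) y + x ≤ 2 * Nat.count (fun j => w.get j = true) x + y + 2 ∧
      2 * Nat.count (fun j => w.get j = true) x + y ≤
        2 * Nat.count (fun j => w.get j = true) y + x + 2 := by
    intro x y hxy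
    obtain ⟨n, rfl⟩ := Nat.exists_eq_add_of_le hxy
    have h1 := window true x n
    have h2 := window false x n
    have h3 := count_false_add_count_true w x
    have h4 := count_false_add_count_true w (x + n)
    omega
  have double : ∀ n, w.get (n + 1) = w.get n →
      Nat.count (fun j => w.get j = true) (n + 2) = Nat.count (fun j => w.get j = true) n ∨
      Nat.count (fun j => w.get j = true) (n + 2) = Nat.count (fun j => w.get j = true) n + 2 := by
    intro n hn
    rw [count_add_two, hn]
    cases w.get n <;> simp
  by_contra hcon
  push Not at hcon
  obtain ⟨i, hi⟩ := hcon 0 (by omega)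
  obtain ⟨j, hj⟩ := hcon 1 le_rfl
  have di := double (2 * i) (by simpa using hi)
  have dj := double (2 * j + 1) (by simpa using hj)
  -- The double letters at `2i` and `2j + 1` each span the full band, but with values of `D` of
  -- opposite parity. The cases only order the four positions, as `bound` needs `x ≤ y`.
  rcases le_or_gt i j with hij | hij
  · have b1 := bound (2 * i) (2 * j + 1) (by omega)
    have b2 := bound (2 * i) (2 * j + 1 + 2) (by omega)
    rcases Nat.eq_or_lt_of_le hij with rfl | hlt
    · have b3 := bound (2 * i + 2) (2 * i + 1 + 2) (by omega)
      have b4 := bound (2 * i + 1) (2 * i + 2) (by omega)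
      omega
    · have b3 := bound (2 * i + 2) (2 * j + 1) (by omega)
      have b4 := bound (2 * i + 2) (2 * j + 1 + 2) (by omega)
      omega
  · have b1 := bound (2 * j + 1) (2 * i) (by omega)
    have b2 := bound (2 * j + 1) (2 * i + 2) (by omega)
    have b4 := bound (2 * j + 1 + 2) (2 * i + 2) (by omega)
    rcases Nat.eq_or_lt_of_le (Nat.succ_le_of_lt hij) with heq | hlt
    · obtain rfl : i = j + 1 := by omega
      have b3 := bound (2 * (j + 1)) (2 * j + 1 + 2) (by omega)
      omega
    · have b3 := bound (2 * j + 1 + 2) (2 * i) (by omega)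
      omega

theorem corollary3 (w : InfWord) (hw : IsAperiodicWord w) :
    (PNF₁ w = [true] ++ₛ Stream'.cycle [true, false] (List.cons_ne_nil _ _) ∧
      PNF₀ w = [false] ++ₛ Stream'.cycle [false, true] (List.cons_ne_nil _ _)) ↔
    ∃ w' : InfWord,
      w = thueMorse w' ∨ w = [false] ++ₛ thueMorse w' ∨ w = [true] ++ₛ thueMorse w' := by
  rw [PNF₁_eq_iff, PNF₀_eq_iff, thueMorse_shape_iff]
  constructor
  · rintro ⟨h1, h0⟩
    exact blocks_of_maxCount w fun a => by cases a <;> assumption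
  · rintro ⟨p, hp1, hp⟩
    exact ⟨maxCount_of_blocks w hw.2 p hp1 hp true, maxCount_of_blocks w hw.2 p hp1 hp false⟩
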